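/- Let $\Gamma$ be a weighted directed multigraph with finite vertex set $V$ and finitely many arcs, each arc having a positive weight. A route from $i$ to $j$ is an alternating sequence of vertices and arcs from $i$ to $j$, each arc going from the vertex before it to the vertex after it (the sequence consisting of a single vertex is a route of weight $1$); a path is a route with distinct vertices. $\Gamma$ is strong if it has a path from every vertex to every vertex. The weight of a route or of a subdigraph is the product of the weights of its arcs (with repetitions for routes), and the weight of a set of these is the sum of the weights of its elements. A real matrix $S=(s_{ij})_{i,j\in V}$ determines a transitional measure for $\Gamma$ if for all $i,j,k\in V$ one has $s_{ij}s_{jk}\le s_{ik}s_{jj}$, with equality if and only if every path in $\Gamma$ from $i$ to $k$ contains $j$. For a matrix $S$ with positive entries that determines a transitional measure for $\Gamma$, the logarithmic distance corresponding to $S$ is $$d(i,j)=\tfrac12\left(\ln s_{ii}+\ln s_{jj}-\ln s_{ij}-\ln s_{ji}\right),\qquad i,j\in V.$$ A function $d\colon V\times V\to\mathbb R$ is graph-geodetic for $\Gamma$ if, for all $i,j,k\in V$, $d(i,j)+d(j,k)=d(i,k)$ holds if and only if every path in $\Gamma$ from $i$ to $k$ and every path in $\Gamma$ from $k$ to $i$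 contains $j$. 1. Let $\Gamma$ be strong and without loops, and let $F=(f_{ij})$ be its matrix of in-forests: $f_{ij}$ is the total weight of the in-forests of $\Gamma$ in which $i$ belongs to a tree rooted at $j$. Here an in-forest is a spanning subdigraph each of whose weakly connected components has one vertex of outdegree $0$ (the root) and all other vertices of outdegree $1$. Then $F$ has positive entries and determines a transitional measure for $\Gamma$, its logarithmic distance is a metric on $V$, and this distance is graph-geodetic for $\Gamma$. 2. Let $\Gamma$ be strong, loops being allowed, and let $R=(r_{ij})$, where $r_{ij}$ is the total weight of all routes from $i$ to $j$ in $\Gamma$. If all $r_{ij}$ are finite, then $R$ has positive entries and determines a transitional measure for $\Gamma$, its logarithmic distance is a metric on $V$, and this distance is graph-geodetic for $\Gamma$. -/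

import Mathlib

/-- A weighted directed multigraph on the vertex set `V`, loops and parallel arcs allowed:
`numArcs i j` arcs go from `i` to `j`, and the `p`-th of them has weight `weight i j p > 0`. -/
structure WMultidigraph (V : Type*) where
  numArcs : V → V → ℕ
  weight : ∀ i j : V, Fin (numArcs i j) → ℝ
  weight_pos : ∀ (i j : V) (p : Fin (numArcs i j)), 0 < weight i j p

namespace WMultidigraph

/-- `G` has no loops. -/
def Loopless {V : Type*} (G : WMultidigraph V) : Prop :=
  ∀ i : V, G.numArcs i i = 0

/-! ### Routes and paths -/

/-- `G.Route i j` is the type of all routes (walks) from `i` to `j` in `G`: alternating sequences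
of vertices and arcs, each arc going from the vertex before it to the vertex after it. -/
inductive Route {V : Type*} (G : WMultidigraph V) : V → V → Type _
  | nil (i : V) : Route G i i
  | cons {i j k : V} (a : Fin (G.numArcs i j)) (r : Route G j k) : Route G i k

/-- The list of the vertices of a route, in order and with repetitions, both ends included. -/
def Route.support {V : Type*} {G : WMultidigraph V} : {i j : V} → G.Route i j → List V
  | _, _, .nil i => [i]
  | i, _, .cons _ r => i :: r.support

/-- The weight of a route: the product of the weights of its arcs, repeated arcs included. -/
def Route.weight {V : Type*} {G : WMultidigraph V} : {i j : V} → G.Route i j → ℝ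
  | _, _, .nil _ => 1
  | _, _, .cons a r => G.weight _ _ a * r.weight

/-- A path is a route whose vertices are all distinct. -/
def Route.IsPath {V : Type*} {G : WMultidigraph V} {i j : V} (r : G.Route i j) : Prop :=
  r.support.Nodup

/-- `G` is strong: there is a path from every vertex to every vertex. -/
def IsStrong {V : Type*} (G : WMultidigraph V) : Prop :=
  ∀ i j : V, ∃ r : G.Route i j, r.IsPath

/-- Every directed path from `i` to `k` contains `j`. -/
def EveryPathContains {V : Type*} (G : WMultidigraph V) (i j k : V) : Prop :=
  ∀ r : G.Route i k, r.IsPath → j ∈ r.support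

/-- The total weight, possibly infinite, of the set of all routes from `i` to `j`. -/
noncomputable def routeWeight {V : Type*} (G : WMultidigraph V) (i j : V) : ENNReal :=
  ∑' r : G.Route i j, ENNReal.ofReal r.weight

/-- The matrix of route weights is finite. -/
def FiniteRouteWeights {V : Type*} (G : WMultidigraph V) : Prop :=
  ∀ i j : V, G.routeWeight i j ≠ ⊤

/-- The matrix `R` of route weights as a real matrix (meaningful if `G.FiniteRouteWeights`). -/
noncomputable def routeMatrix {V : Type*} (G : WMultidigraph V) : Matrix V V ℝ :=
  fun i j => (G.routeWeight i j).toReal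

/-! ### In-forests -/

/-- The arcs of `G`: `⟨i, j, p⟩` is the `p`-th arc from `i` to `j`. -/
abbrev Arc {V : Type*} (G : WMultidigraph V) : Type _ :=
  Σ i : V, Σ j : V, Fin (G.numArcs i j)

/-- The initial vertex of an arc. -/
def Arc.source {V : Type*} {G : WMultidigraph V} (a : G.Arc) : V := a.1

/-- The terminal vertex of an arc. -/
def Arc.target {V : Type*} {G : WMultidigraph V} (a : G.Arc) : V := a.2.1

/-- The weight of an arc. -/
def Arc.weight {V : Type*} {G : WMultidigraph V} (a : G.Arc) : ℝ := G.weight a.1 a.2.1 a.2.2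

open Classical in
/-- The outdegree of `v` in the spanning subdigraph of `G` with arc set `H`. -/
noncomputable def outdegree {V : Type*} {G : WMultidigraph V} (H : Finset G.Arc) (v : V) : ℕ :=
  (H.filter (fun a => a.source = v)).card

/-- The vertex set of the weakly connected component that contains `v`, in the spanning subdigraph
of `G` with arc set `H`. -/
def weakComponent {V : Type*} {G : WMultidigraph V} (H : Finset G.Arc) (v : V) : Set V :=
  {u | Relation.EqvGen (fun x y : V => ∃ a ∈ H, a.source = x ∧ a.target = y) v u}

/-- The weakly connected component of `v`, in the spanning subdigraph of `G` with arc set `H`, is a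
converging tree with root `r`: the root has outdegree zero and every other vertex has outdegree one.
(All arcs of `H` that start in a component belong to that component.) -/
def IsConvergingTreeAt {V : Type*} {G : WMultidigraph V} (H : Finset G.Arc) (v r : V) : Prop :=
  r ∈ weakComponent H v ∧ outdegree H r = 0 ∧
    ∀ u ∈ weakComponent H v, u ≠ r → outdegree H u = 1

/-- The spanning subdigraph of `G` with arc set `H` is an in-forest of `G`: each of its weakly
connected components is a converging tree. -/
def IsInForest {V : Type*} {G : WMultidigraph V} (H : Finset G.Arc) : Prop :=
  ∀ v : V, ∃ r : V, IsConvergingTreeAt H v r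

open Classical in
/-- The set of the in-forests of `G` (given by their arc sets) in which `i` belongs to a tree
rooted at `j`. -/
noncomputable def inForests {V : Type*} [Fintype V] (G : WMultidigraph V) (i j : V) :
    Finset (Finset G.Arc) :=
  Finset.univ.filter (fun H => IsInForest H ∧ IsConvergingTreeAt H i j)

/-- The matrix `F` of in-forests: `f i j` is the total weight of the in-forests in which `i` belongs
to a tree rooted at `j`, the weight of a forest being the product of the weights of its arcs. -/
noncomputable def inForestMatrix {V : Type*} [Fintype V] (G : WMultidigraph V) : Matrix V V ℝ :=
  fun i j => ∑ H ∈ G.inForests i j, ∏ a ∈ H, a.weight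

/-! ### Transitional measures, logarithmic distances, the graph-geodetic property -/

/-- `S` determines a transitional measure for `G`: it satisfies the transition inequality and the
graph bottleneck identity with respect to `G`. -/
def IsTransitional {V : Type*} (G : WMultidigraph V) (S : Matrix V V ℝ) : Prop :=
  (∀ i j k : V, S i j * S j k ≤ S i k * S j j) ∧
    ∀ i j k : V, S i j * S j k = S i k * S j j ↔ G.EveryPathContains i j k

/-- `d` is graph-geodetic for `G`: `d i j + d j k = d i k` holds if and only if every directed path
connecting `i` and `k`, in either direction, contains `j`. -/
def IsGraphGeodetic {V : Type*} (G : WMultidigraph V) (d : V → V → ℝ) : Prop :=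
  ∀ i j k : V, d i j + d j k = d i k ↔ G.EveryPathContains i j k ∧ G.EveryPathContains k j i

end WMultidigraph

/-- The logarithmic transformation `D = ½ (h 1ᵀ + 1 hᵀ - H - Hᵀ)` of `S`, written elementwise, where
`H` is the elementwise logarithm of `S` and `h` is the diagonal of `H`. -/
noncomputable def logDistance {V : Type*} (S : Matrix V V ℝ) (i j : V) : ℝ :=
  (1 / 2) * (Real.log (S i i) + Real.log (S j j) - Real.log (S i j) - Real.log (S j i))

/-- `d` is a distance (metric) on `V`. -/
def IsDistance {V : Type*} (d : V → V → ℝ) : Prop :=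
  (∀ i j : V, 0 ≤ d i j) ∧ (∀ i j : V, d i j = 0 ↔ i = j) ∧ (∀ i j : V, d i j = d j i) ∧
    ∀ i j k : V, d i k ≤ d i j + d j k

/-- The logarithmic distance corresponding to `S` is well defined for `G`: all entries of `S` are
positive, `S` determines a transitional measure for `G`, and the logarithmic transformation of `S`
is a distance. -/
def WMultidigraph.HasLogDistance {V : Type*} (G : WMultidigraph V) (S : Matrix V V ℝ) : Prop :=
  (∀ i j : V, 0 < S i j) ∧ G.IsTransitional S ∧ IsDistance (logDistance S)

/-!
Both matrices satisfy a balance equation with respect to the total arc weights `A i m`: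
`d i * S i j = ∑ m, A i m * S m j + [i = j] * c j`, where `d` and `c` are positive
(`WMultidigraph.IsBalanced`). For the route matrix this is the decomposition of a route by its
first arc, with `d = c = 1` (`isBalanced_routeMatrix`). For the in-forest matrix `d i` is `1` plus
the total weight of the arcs leaving `i`, and the equation is obtained by grouping the in-forests
according to what remains of them once the arc leaving `i` is deleted (`isBalanced_inForestMatrix`);
this is the combinatorial content of the matrix forest theorem, and no determinants are needed.

The balance equation suffices (`IsBalanced.isTransitional`). For fixed `j` and `k` let
`u i = S i k * S j j - S i j * S j k`. Then `u j = 0`, and `u` is superharmonic outside `j`, as is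
the positive function `i ↦ S i j`, so a minimum principle for the quotient of the two gives `0 ≤ u`
(`nonneg_of_superharmonic`). If `u i = 0` then `u` vanishes along every route from `i` up to its
first visit to `j`; since `u` cannot vanish at `k ≠ j`, each route from `i` to `k` meets `j`.
Conversely, on the set of vertices from which every route to `k` meets `j`, the function `-u` is
superharmonic outside `j` as well, so `u` is zero there.

Finally, `d(i,j) + d(j,k) - d(i,k)` is half the sum of the logarithms of the ratios
`S i k * S j j / (S i j * S j k)` and `S k i * S j j / (S k j * S j i)`, which are at least `1` and
equal to `1` exactly in the cases described by the bottleneck identity. This yields the metric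
axioms and the graph-geodetic property.
-/

/-! ### Logarithmic distances of positive transitional matrices -/

namespace WMultidigraph

section Routes

variable {V : Type*} {G : WMultidigraph V}

theorem Route.start_mem_support {i j : V} (r : G.Route i j) : i ∈ r.support := by
  cases r <;> simp [Route.support]

theorem everyPathContains_self_iff {i j : V} : G.EveryPathContains i j i ↔ i = j := by
  constructor
  · intro h
    have := h (.nil i) (by simp [Route.IsPath, Route.support])
    simpa [Route.support, eq_comm] using this
  · rintro rfl r _
    exact r.start_mem_support

variable {S : Matrix V V ℝ}

/-- The defect in the triangle inequality is a sum of two nonnegative logarithmic ratios. -/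
theorem logDistance_add_sub (i j k : V) :
    logDistance S i j + logDistance S j k - logDistance S i k =
      1 / 2 * ((Real.log (S i k) + Real.log (S j j) - (Real.log (S i j) + Real.log (S j k))) +
        (Real.log (S k i) + Real.log (S j j) - (Real.log (S k j) + Real.log (S j i)))) := by
  unfold logDistance; ring

theorem IsTransitional.log_le (hS : G.IsTransitional S) (hpos : ∀ i j, 0 < S i j) (i j k : V) :
    0 ≤ Real.log (S i k) + Real.log (S j j) - (Real.log (S i j) + Real.log (S j k)) := by
  rw [← Real.log_mul (hpos _ _).ne' (hpos _ _).ne', ← Real.log_mul (hpos _ _).ne' (hpos _ _).ne',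
    sub_nonneg]
  exact Real.log_le_log (mul_pos (hpos _ _) (hpos _ _)) (hS.1 i j k)

theorem IsTransitional.log_eq_zero_iff (hS : G.IsTransitional S) (hpos : ∀ i j, 0 < S i j)
    (i j k : V) :
    Real.log (S i k) + Real.log (S j j) - (Real.log (S i j) + Real.log (S j k)) = 0 ↔
      G.EveryPathContains i j k := by
  rw [← Real.log_mul (hpos _ _).ne' (hpos _ _).ne', ← Real.log_mul (hpos _ _).ne' (hpos _ _).ne',
    sub_eq_zero, ← hS.2 i j k, eq_comm]
  exact Real.log_injOn_pos.eq_iff (mul_pos (hpos _ _) (hpos _ _)) (mul_pos (hpos _ _) (hpos _ _))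

theorem IsTransitional.isGraphGeodetic_logDistance (hS : G.IsTransitional S)
    (hpos : ∀ i j, 0 < S i j) : G.IsGraphGeodetic (logDistance S) := by
  intro i j k
  rw [← hS.log_eq_zero_iff hpos, ← hS.log_eq_zero_iff hpos, ← sub_eq_zero, logDistance_add_sub,
    ← add_eq_zero_iff_of_nonneg (hS.log_le hpos i j k) (hS.log_le hpos k j i)]
  simp

theorem logDistance_self (i : V) : logDistance S i i = 0 := by
  unfold logDistance; ring

theorem logDistance_comm (i j : V) : logDistance S i j = logDistance S j i := by
  unfold logDistance; ring

theorem IsTransitional.isDistance_logDistance (hS : G.IsTransitional S)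
    (hpos : ∀ i j, 0 < S i j) : IsDistance (logDistance S) := by
  have triangle (i j k : V) : logDistance S i k ≤ logDistance S i j + logDistance S j k := by
    have h := logDistance_add_sub (S := S) i j k
    have h1 := hS.log_le hpos i j k
    have h2 := hS.log_le hpos k j i
    linarith
  refine ⟨fun i j => ?_, fun i j => ?_, logDistance_comm, triangle⟩
  · have h := triangle i j i
    rw [logDistance_self, logDistance_comm j i] at h
    linarith
  · -- `d(i,j) = 0` is the geodetic equality for the triple `i, j, i`.
    have h := hS.isGraphGeodetic_logDistance hpos i j i
    rw [logDistance_self, logDistance_comm j i, everyPathContains_self_iff, and_self] at h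
    rw [← h]
    constructor <;> intro h' <;> linarith

/-! ### Routes versus paths -/

theorem Route.IsPath.exists_suffix {i k v : V} {r : G.Route i k} (hr : r.IsPath)
    (hv : v ∈ r.support) : ∃ q : G.Route v k, q.IsPath ∧ q.support ⊆ r.support := by
  induction r with
  | nil i =>
    obtain rfl : v = i := by simpa [Route.support] using hv
    exact ⟨.nil v, hr, fun _ h => h⟩
  | @cons i m k a r ih =>
    by_cases hvi : v = i
    · subst hvi
      exact ⟨.cons a r, hr, fun _ h => h⟩
    · obtain ⟨q, hq, hsub⟩ := ih (List.Nodup.of_cons hr)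
        ((List.mem_cons.1 hv).resolve_left hvi)
      exact ⟨q, hq, fun _ h => List.mem_cons_of_mem _ (hsub h)⟩

/-- Loop erasure. -/
theorem Route.exists_isPath_support_subset {i k : V} (r : G.Route i k) :
    ∃ q : G.Route i k, q.IsPath ∧ q.support ⊆ r.support := by
  induction r with
  | nil i => exact ⟨.nil i, by simp [Route.IsPath, Route.support], fun _ h => h⟩
  | @cons i m k a r ih =>
    obtain ⟨q, hq, hsub⟩ := ih
    by_cases hi : i ∈ q.support
    · obtain ⟨q', hq', hsub'⟩ := hq.exists_suffix hi
      exact ⟨q', hq', fun _ h => List.mem_cons_of_mem _ (hsub (hsub' h))⟩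
    · exact ⟨.cons a q, List.nodup_cons.2 ⟨hi, hq⟩, List.cons_subset_cons _ hsub⟩

theorem everyPathContains_iff_forall_route {i j k : V} :
    G.EveryPathContains i j k ↔ ∀ r : G.Route i k, j ∈ r.support := by
  refine ⟨fun h r => ?_, fun h r _ => h r⟩
  obtain ⟨q, hq, hsub⟩ := r.exists_isPath_support_subset
  exact hsub (h q hq)

/-! ### The balance equation and the minimum principle -/

/-- The weighted adjacency matrix: the total weight of the arcs from `i` to `j`. -/
noncomputable def arcWeight (G : WMultidigraph V) (i j : V) : ℝ := ∑ p, G.weight i j p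

theorem arcWeight_nonneg (i j : V) : 0 ≤ G.arcWeight i j :=
  Finset.sum_nonneg fun p _ => (G.weight_pos i j p).le

theorem arcWeight_pos {i j : V} (p : Fin (G.numArcs i j)) : 0 < G.arcWeight i j :=
  Finset.sum_pos (fun p _ => G.weight_pos i j p) ⟨p, Finset.mem_univ p⟩

theorem exists_arc_of_arcWeight_ne_zero {i j : V} (h : G.arcWeight i j ≠ 0) :
    Nonempty (Fin (G.numArcs i j)) := by
  obtain ⟨p, _, _⟩ := Finset.exists_ne_zero_of_sum_ne_zero h
  exact ⟨p⟩

section Balance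

variable [Fintype V]

open Classical in
/-- The balance equation `(diag d - A) S = diag c`, where `A` is the weighted adjacency matrix of
`G`, with positive diagonal matrices `diag d` and `diag c`. -/
def IsBalanced (G : WMultidigraph V) (S : Matrix V V ℝ) : Prop :=
  ∃ d c : V → ℝ, (∀ i, 0 < d i) ∧ (∀ i, 0 < c i) ∧
    ∀ i j, d i * S i j = ∑ m, G.arcWeight i m * S m j + if i = j then c j else 0

/-- The minimum principle. Let `h > 0` and `u` be superharmonic with respect to `d` and the arc
weights, `h` at all vertices other than `j` and `u` at those of them that lie in `W`, a set left by
no arc except perhaps at `j`. If `u j ≥ 0`, then `u ≥ 0` on `W`. -/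
theorem nonneg_of_superharmonic (hG : G.IsStrong) {j : V} {d h u : V → ℝ} {W : Set V}
    (hh : ∀ v, 0 < h v)
    (hsuper : ∀ v, v ≠ j → ∑ m, G.arcWeight v m * h m ≤ d v * h v)
    (hW : ∀ v ∈ W, v ≠ j → ∀ m, Nonempty (Fin (G.numArcs v m)) → m ∈ W)
    (huj : 0 ≤ u j)
    (hu : ∀ v ∈ W, v ≠ j → ∑ m, G.arcWeight v m * u m ≤ d v * u v) :
    ∀ v ∈ W, 0 ≤ u v := by
  by_contra! hneg
  obtain ⟨w, hw, huw⟩ := hneg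
  obtain ⟨v₀, hv₀, hmin⟩ := W.exists_min_image (fun v => u v / h v) W.toFinite ⟨w, hw⟩
  obtain ⟨t, ht⟩ : ∃ t, t = u v₀ / h v₀ := ⟨_, rfl⟩
  have ht0 : t < 0 := by
    rw [ht]; exact (hmin w hw).trans_lt (div_neg_of_neg_of_pos huw (hh w))
  have hle (v) (hv : v ∈ W) : 0 ≤ u v - t * h v := by
    have := hmin v hv
    simp only [← ht] at this
    rw [le_div_iff₀ (hh v)] at this
    linarith
  -- The minimal value `t` of `u / h` propagates along arcs until `j` is reached.
  have key (v k : V) (r : G.Route v k) (hk : k = j) : v ∈ W → u v = t * h v → False := by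
    induction r with
    | nil v =>
      rintro - hv
      have := mul_neg_of_neg_of_pos ht0 (hh v)
      subst hk; linarith
    | @cons v m k a r ih =>
      intro hv huv
      by_cases hvj : v = j
      · have := mul_neg_of_neg_of_pos ht0 (hh v)
        subst hvj; linarith
      have hnn : ∀ x ∈ Finset.univ, 0 ≤ G.arcWeight v x * (u x - t * h x) := by
        intro x _
        by_cases hx : G.arcWeight v x = 0
        · simp [hx]
        · exact mul_nonneg (arcWeight_nonneg v x)
            (hle x (hW v hv hvj x (exists_arc_of_arcWeight_ne_zero hx)))
      have hsum : ∑ x, G.arcWeight v x * (u x - t * h x) = 0 := by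
        refine le_antisymm ?_ (Finset.sum_nonneg hnn)
        have h1 := hu v hv hvj
        have h2 := mul_le_mul_of_nonpos_left (hsuper v hvj) ht0.le
        have h3 : ∑ x, G.arcWeight v x * (u x - t * h x) =
            ∑ x, G.arcWeight v x * u x - t * ∑ x, G.arcWeight v x * h x := by
          rw [Finset.mul_sum, ← Finset.sum_sub_distrib]
          exact Finset.sum_congr rfl fun x _ => by ring
        rw [h3]
        have h4 : d v * u v = t * (d v * h v) := by rw [huv]; ring
        linarith
      have hm := (Finset.sum_eq_zero_iff_of_nonneg hnn).1 hsum m (Finset.mem_univ m)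
      have hm' := (mul_eq_zero.1 hm).resolve_left (arcWeight_pos a).ne'
      exact ih hk (hW v hv hvj m ⟨a⟩) (by linarith)
  obtain ⟨r, -⟩ := hG v₀ j
  exact key v₀ j r rfl hv₀ (by rw [ht, div_mul_cancel₀ _ (hh v₀).ne'])

theorem IsBalanced.isTransitional (hS : G.IsBalanced S) (hG : G.IsStrong)
    (hpos : ∀ i j, 0 < S i j) : G.IsTransitional S := by
  classical
  obtain ⟨d, c, -, hc, heq⟩ := hS
  have hsuper (j v : V) (hv : v ≠ j) : ∑ m, G.arcWeight v m * S m j ≤ d v * S v j := by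
    simp [heq v j, hv]
  have hbal (j k v : V) (hv : v ≠ j) : d v * (S v k * S j j - S v j * S j k) =
      ∑ m, G.arcWeight v m * (S m k * S j j - S m j * S j k) +
        (if v = k then c k else 0) * S j j := by
    have h1 := heq v k
    have h2 := heq v j
    rw [if_neg hv, add_zero] at h2
    calc d v * (S v k * S j j - S v j * S j k)
        = (d v * S v k) * S j j - (d v * S v j) * S j k := by ring
      _ = _ := by
        rw [h1, h2, add_mul, Finset.sum_mul, Finset.sum_mul, add_sub_right_comm,
          ← Finset.sum_sub_distrib]
        congr 1
        exact Finset.sum_congr rfl fun m _ => by ring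
  have hnn (j k v : V) : 0 ≤ S v k * S j j - S v j * S j k := by
    refine nonneg_of_superharmonic (u := fun v => S v k * S j j - S v j * S j k)
      (W := Set.univ) hG (fun v => hpos v j) (hsuper j)
      (fun _ _ _ _ _ => trivial) (by simp [mul_comm]) (fun v _ hv => ?_) v trivial
    rw [hbal j k v hv]
    have : 0 ≤ (if v = k then c k else 0) * S j j :=
      mul_nonneg (by split_ifs; exacts [(hc k).le, le_rfl]) (hpos j j).le
    linarith
  refine ⟨fun i j k => by linarith [hnn j k i], fun i j k => ?_⟩
  rw [everyPathContains_iff_forall_route]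
  constructor
  · intro h r
    by_contra hj
    -- The zero of `u` at `i` propagates along a route that avoids `j`, up to `k`.
    have key (v k : V) (r : G.Route v k) :
        j ∉ r.support → S v k * S j j - S v j * S j k ≠ 0 := by
      induction r with
      | nil v =>
        intro hj h0
        have hvj : v ≠ j := fun h => hj (by simp [Route.support, h])
        have h1 := hbal j v v hvj
        rw [h0, mul_zero, if_pos rfl] at h1
        have h2 : 0 ≤ ∑ m, G.arcWeight v m * (S m v * S j j - S m j * S j v) :=
          Finset.sum_nonneg fun m _ => mul_nonneg (arcWeight_nonneg v m) (hnn j v m)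
        have h3 := mul_pos (hc v) (hpos j j)
        linarith
      | @cons v m k a r ih =>
        intro hj h0
        have hj' : j ≠ v ∧ j ∉ r.support := by simpa [Route.support] using hj
        have h1 := hbal j k v hj'.1.symm
        rw [h0, mul_zero] at h1
        have h2 : ∀ x ∈ Finset.univ, 0 ≤ G.arcWeight v x * (S x k * S j j - S x j * S j k) :=
          fun x _ => mul_nonneg (arcWeight_nonneg v x) (hnn j k x)
        have h3 : 0 ≤ (if v = k then c k else 0) * S j j :=
          mul_nonneg (by split_ifs; exacts [(hc k).le, le_rfl]) (hpos j j).le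
        have h4 := Finset.sum_nonneg h2
        have h5 := (Finset.sum_eq_zero_iff_of_nonneg h2).1 (by linarith) m (Finset.mem_univ m)
        exact ih hj'.2 ((mul_eq_zero.1 h5).resolve_left (arcWeight_pos a).ne')
    exact key i k r hj (by linarith)
  · intro h
    have := nonneg_of_superharmonic (u := fun v => -(S v k * S j j - S v j * S j k))
      (W := {v | ∀ r : G.Route v k, j ∈ r.support}) hG (fun v => hpos v j) (hsuper j)
      (fun v hv hvj m ⟨a⟩ r => ?_) (by simp [mul_comm]) (fun v hv hvj => ?_) i h
    · have h2 := hnn j k i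
      linarith
    · exact (List.mem_cons.1 (hv (.cons a r))).resolve_left hvj.symm
    · have hvk : v ≠ k := by
        rintro rfl
        have := hv (.nil v)
        simp only [Route.support, List.mem_singleton] at this
        exact hvj this.symm
      have h1 := hbal j k v hvj
      rw [if_neg hvk, zero_mul, add_zero] at h1
      simp only [mul_neg, Finset.sum_neg_distrib, h1, le_refl]

theorem IsBalanced.hasLogDistance_and_isGraphGeodetic (hS : G.IsBalanced S) (hG : G.IsStrong)
    (hpos : ∀ i j, 0 < S i j) :
    G.HasLogDistance S ∧ G.IsGraphGeodetic (logDistance S) :=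
  have hT := hS.isTransitional hG hpos
  ⟨⟨hpos, hT, hT.isDistance_logDistance hpos⟩, hT.isGraphGeodetic_logDistance hpos⟩

end Balance

/-! ### The route matrix -/

theorem Route.weight_pos {i j : V} (r : G.Route i j) : 0 < r.weight := by
  induction r with
  | nil => exact one_pos
  | cons a r ih => exact mul_pos (G.weight_pos _ _ a) ih

/-- A route is either trivial or an arc followed by a route. -/
def Route.equivSum (G : WMultidigraph V) (i j : V) :
    G.Route i j ≃ PLift (i = j) ⊕ Σ m : V, Σ _ : Fin (G.numArcs i m), G.Route m j where
  toFun
    | .nil _ => .inl ⟨rfl⟩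
    | .cons a r => .inr ⟨_, a, r⟩
  invFun
    | .inl ⟨h⟩ => h ▸ .nil i
    | .inr ⟨_, a, r⟩ => .cons a r
  left_inv r := by cases r <;> rfl
  right_inv x := by
    rcases x with ⟨⟨rfl⟩⟩ | ⟨m, a, r⟩ <;> rfl

theorem routeMatrix_pos (hG : G.IsStrong) (hfin : G.FiniteRouteWeights) (i j : V) :
    0 < G.routeMatrix i j := by
  obtain ⟨r, -⟩ := hG i j
  refine ENNReal.toReal_pos (fun h => ?_) (hfin i j)
  have := ENNReal.tsum_eq_zero.1 h r
  exact absurd (ENNReal.ofReal_eq_zero.1 this) r.weight_pos.not_ge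

variable [Fintype V]

open Classical in
theorem routeWeight_eq (i j : V) :
    G.routeWeight i j = (if i = j then 1 else 0) +
      ∑ m, ∑ p, ENNReal.ofReal (G.weight i m p) * G.routeWeight m j := by
  unfold routeWeight
  rw [← (Route.equivSum G i j).symm.tsum_eq,
    Summable.tsum_sum ENNReal.summable ENNReal.summable]
  congr 1
  · by_cases h : i = j
    · subst h
      have : Unique (PLift (i = i)) := ⟨⟨⟨rfl⟩⟩, fun _ => rfl⟩
      rw [tsum_fintype, Fintype.sum_unique]
      simp [Route.equivSum, Route.weight]
    · have : IsEmpty (PLift (i = j)) := ⟨fun x => h x.down⟩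
      rw [tsum_empty, if_neg h]
  · rw [ENNReal.tsum_sigma', tsum_fintype]
    refine Finset.sum_congr rfl fun m _ => ?_
    rw [ENNReal.tsum_sigma', tsum_fintype]
    refine Finset.sum_congr rfl fun p _ => ?_
    rw [← ENNReal.tsum_mul_left]
    refine tsum_congr fun r => ?_
    exact ENNReal.ofReal_mul (G.weight_pos i m p).le

theorem isBalanced_routeMatrix (hfin : G.FiniteRouteWeights) : G.IsBalanced G.routeMatrix := by
  classical
  refine ⟨fun _ => 1, fun _ => 1, fun _ => one_pos, fun _ => one_pos, fun i j => ?_⟩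
  have hne (m : V) (p : Fin (G.numArcs i m)) :
      ENNReal.ofReal (G.weight i m p) * G.routeWeight m j ≠ ⊤ :=
    ENNReal.mul_ne_top ENNReal.ofReal_ne_top (hfin m j)
  rw [one_mul, add_comm]
  unfold routeMatrix
  rw [routeWeight_eq i j, ENNReal.toReal_add (by split_ifs <;> simp)
    (ENNReal.sum_ne_top.2 fun m _ => ENNReal.sum_ne_top.2 fun p _ => hne m p),
    ENNReal.toReal_sum fun m _ => ENNReal.sum_ne_top.2 fun p _ => hne m p]
  congr 1
  · split_ifs <;> simp
  · refine Finset.sum_congr rfl fun m _ => ?_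
    rw [ENNReal.toReal_sum fun p _ => hne m p, arcWeight, Finset.sum_mul]
    refine Finset.sum_congr rfl fun p _ => ?_
    rw [ENNReal.toReal_mul, ENNReal.toReal_ofReal (G.weight_pos i m p).le]

end Routes

/-! ### In-forests as acyclic systems of out-arcs -/

section Descent

variable {V : Type*} {G : WMultidigraph V} {H : Finset G.Arc}

/-- `DescendsTo H v r`: starting at `v` and always following the only arc of `H` that leaves the
current vertex, one arrives at `r`, which no arc of `H` leaves. -/
inductive DescendsTo (H : Finset G.Arc) : V → V → Prop
  | root (r : V) (hr : ∀ a ∈ H, a.source ≠ r) : DescendsTo H r r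
  | step (a : G.Arc) (ha : a ∈ H) (huniq : ∀ b ∈ H, b.source = a.source → b = a) (r : V)
      (h : DescendsTo H a.target r) : DescendsTo H a.source r

theorem DescendsTo.not_source {v r : V} (h : DescendsTo H v r) : ∀ a ∈ H, a.source ≠ r := by
  induction h with
  | root r hr => exact hr
  | step a ha hu r h ih => exact ih

theorem DescendsTo.target_of_source {v r : V} (h : DescendsTo H v r) {a : G.Arc} (ha : a ∈ H)
    (hv : a.source = v) : DescendsTo H a.target r := by
  cases h with
  | root _ hr => exact absurd hv (hr a ha)
  | step b hb hu _ h => rwa [hu a ha hv]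

theorem DescendsTo.eq_of_forall_source_ne {v r : V} (h : DescendsTo H v r)
    (hv : ∀ a ∈ H, a.source ≠ v) : r = v := by
  cases h with
  | root => rfl
  | step a ha => exact absurd rfl (hv a ha)

theorem DescendsTo.unique {v r s : V} (h : DescendsTo H v r) (h' : DescendsTo H v s) : r = s := by
  induction h with
  | root r hr => exact (h'.eq_of_forall_source_ne hr).symm
  | step a ha hu r h ih => exact ih (h'.target_of_source ha rfl)

theorem outdegree_eq_zero_iff {v : V} : outdegree H v = 0 ↔ ∀ a ∈ H, a.source ≠ v := by
  simp [outdegree, Finset.filter_eq_empty_iff]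

theorem outdegree_eq_one_iff {v : V} :
    outdegree H v = 1 ↔ ∃ a ∈ H, a.source = v ∧ ∀ b ∈ H, b.source = v → b = a := by
  classical
  rw [outdegree, Finset.card_eq_one]
  simp only [Finset.eq_singleton_iff_unique_mem, Finset.mem_filter, and_imp, and_assoc]

theorem DescendsTo.outdegree_eq_one {v r : V} (h : DescendsTo H v r) (hne : v ≠ r) :
    outdegree H v = 1 := by
  cases h with
  | root => exact absurd rfl hne
  | step a ha hu => exact outdegree_eq_one_iff.2 ⟨a, ha, rfl, hu⟩

theorem DescendsTo.mem_weakComponent {v r : V} (h : DescendsTo H v r) : r ∈ weakComponent H v := by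
  induction h with
  | root r => exact .refl r
  | step a ha hu r h ih => exact .trans _ _ _ (.rel _ _ ⟨a, ha, rfl, rfl⟩) ih

/-- In a converging tree every vertex descends to the root: the vertices that do form a set closed
under weak adjacency. -/
theorem IsConvergingTreeAt.descendsTo {v r : V} (h : IsConvergingTreeAt H v r) :
    DescendsTo H v r := by
  obtain ⟨hr, h0, h1⟩ := h
  have key (x y : V)
      (hxy : Relation.EqvGen (fun x y : V => ∃ a ∈ H, a.source = x ∧ a.target = y) x y) :
      x ∈ weakComponent H v → (DescendsTo H x r ↔ DescendsTo H y r) := by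
    induction hxy with
    | rel x y hxy =>
      intro hx
      obtain ⟨a, ha, rfl, rfl⟩ := hxy
      refine ⟨fun h => h.target_of_source ha rfl, fun h => ?_⟩
      have hne : a.source ≠ r := outdegree_eq_zero_iff.1 h0 a ha
      obtain ⟨b, hb, hba, hu⟩ := outdegree_eq_one_iff.1 (h1 _ hx hne)
      refine .step a ha (fun e he hea => ?_) r h
      rw [hu e he hea, hu a ha rfl]
    | refl x => exact fun _ => Iff.rfl
    | symm x y hxy ih =>
      exact fun hy => (ih (Relation.EqvGen.trans _ _ _ hy (.symm _ _ hxy))).symm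
    | trans x y z hxy hyz ih1 ih2 =>
      exact fun hx => (ih1 hx).trans (ih2 (Relation.EqvGen.trans _ _ _ hx hxy))
  exact (key v r hr (.refl v)).2 (.root r (outdegree_eq_zero_iff.1 h0))

theorem isInForest_iff : IsInForest H ↔ ∀ v, ∃ r, DescendsTo H v r := by
  refine ⟨fun h v => (h v).imp fun r hr => hr.descendsTo, fun h v => ?_⟩
  obtain ⟨r, hr⟩ := h v
  refine ⟨r, hr.mem_weakComponent, outdegree_eq_zero_iff.2 hr.not_source, fun u hu hne => ?_⟩
  have key (x y : V)
      (hxy : Relation.EqvGen (fun x y : V => ∃ a ∈ H, a.source = x ∧ a.target = y) x y) :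
      ∀ s, DescendsTo H x s ↔ DescendsTo H y s := by
    induction hxy with
    | rel x y hxy =>
      obtain ⟨a, ha, rfl, rfl⟩ := hxy
      intro s
      refine ⟨fun h => h.target_of_source ha rfl, fun hs => ?_⟩
      obtain ⟨s', hs'⟩ := h a.source
      rwa [hs.unique (hs'.target_of_source ha rfl)]
    | refl x => exact fun _ => Iff.rfl
    | symm x y _ ih => exact fun s => (ih s).symm
    | trans x y z _ _ ih1 ih2 => exact fun s => (ih1 s).trans (ih2 s)
  exact ((key v u hu r).1 hr).outdegree_eq_one hne

theorem IsInForest.isConvergingTreeAt_iff (hH : IsInForest H) {v r : V} :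
    IsConvergingTreeAt H v r ↔ DescendsTo H v r := by
  refine ⟨fun h => h.descendsTo, fun h => ?_⟩
  obtain ⟨s, hs⟩ := hH v
  rwa [h.unique hs.descendsTo]

theorem isInForest_empty : IsInForest (∅ : Finset G.Arc) :=
  isInForest_iff.2 fun v => ⟨v, .root v (by simp)⟩

/-! ### Deleting and inserting the arc that leaves a given vertex -/

open Classical in
theorem IsInForest.filter_source_ne (hH : IsInForest H) (i : V) :
    IsInForest (H.filter fun a => a.source ≠ i) := by
  rw [isInForest_iff] at hH ⊢
  intro v
  obtain ⟨r, hr⟩ := hH v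
  induction hr with
  | root r hr => exact ⟨r, .root r fun a ha => hr a (Finset.mem_filter.1 ha).1⟩
  | step a ha hu r h ih =>
    by_cases hai : a.source = i
    · exact ⟨a.source, .root _ fun b hb => by rw [hai]; exact (Finset.mem_filter.1 hb).2⟩
    · obtain ⟨s, hs⟩ := ih
      exact ⟨s, .step a (Finset.mem_filter.2 ⟨ha, hai⟩)
        (fun b hb => hu b (Finset.mem_filter.1 hb).1) s hs⟩

variable {i : V} {e : G.Arc}

open Classical in
theorem DescendsTo.insert_of_ne (hi : ∀ a ∈ H, a.source ≠ i) (he : e.source = i) {v r : V}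
    (h : DescendsTo H v r) (hr : r ≠ i) : DescendsTo (insert e H) v r := by
  induction h with
  | root r h0 =>
    refine .root r fun a ha => ?_
    rcases Finset.mem_insert.1 ha with rfl | ha
    · rw [he]; exact hr.symm
    · exact h0 a ha
  | step a ha hu r h ih =>
    refine .step a (Finset.mem_insert_of_mem ha) (fun b hb hba => ?_) r (ih hr)
    rcases Finset.mem_insert.1 hb with rfl | hb
    · exact absurd (hba.symm.trans he) (hi a ha)
    · exact hu b hb hba

open Classical in
theorem DescendsTo.insert_of_eq (hi : ∀ a ∈ H, a.source ≠ i) (he : e.source = i) {v r : V}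
    (h : DescendsTo H v i) (hr : DescendsTo (insert e H) e.target r) :
    DescendsTo (insert e H) v r := by
  generalize hs : i = s at h
  induction h with
  | root s h0 =>
    subst hs; subst he
    refine .step e (Finset.mem_insert_self _ _) (fun b hb hba => ?_) r hr
    rcases Finset.mem_insert.1 hb with rfl | hb
    · rfl
    · exact absurd hba (hi b hb)
  | step a ha hu s h ih =>
    refine .step a (Finset.mem_insert_of_mem ha) (fun b hb hba => ?_) r (ih hs)
    rcases Finset.mem_insert.1 hb with rfl | hb
    · exact absurd (hba.symm.trans he) (hi a ha)
    · exact hu b hb hba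

open Classical in
/-- Inserting an arc from `i` to a vertex that descends to `i` creates a cycle, and the vertices
that used to descend to `i` do not descend to any vertex any more. -/
theorem DescendsTo.not_descendsTo_insert (he : e.source = i) (hcyc : DescendsTo H e.target i)
    {v : V} (hv : DescendsTo H v i) (r : V) : ¬ DescendsTo (insert e H) v r := by
  intro h
  induction h with
  | root r h0 =>
    have := hv.eq_of_forall_source_ne fun a ha => h0 a (Finset.mem_insert_of_mem ha)
    exact h0 e (Finset.mem_insert_self _ _) (he.trans this)
  | step a ha hu r h ih =>
    rcases Finset.mem_insert.1 ha with rfl | ha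
    · exact ih hcyc
    · exact ih (hv.target_of_source ha rfl)

open Classical in
theorem isInForest_insert_iff (hH : IsInForest H) (hi : ∀ a ∈ H, a.source ≠ i)
    (he : e.source = i) : IsInForest (insert e H) ↔ ¬ DescendsTo H e.target i := by
  rw [isInForest_iff] at hH ⊢
  constructor
  · intro h hcyc
    obtain ⟨r, hr⟩ := h e.target
    exact hcyc.not_descendsTo_insert he hcyc r hr
  · intro hcyc v
    obtain ⟨s, hs⟩ := hH e.target
    have hsi : s ≠ i := by rintro rfl; exact hcyc hs
    have hs' := hs.insert_of_ne hi he hsi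
    obtain ⟨r, hr⟩ := hH v
    by_cases hri : r = i
    · subst hri
      exact ⟨s, hr.insert_of_eq hi he hs'⟩
    · exact ⟨r, hr.insert_of_ne hi he hri⟩

open Classical in
/-- Where a vertex descends to after the insertion of an arc `e` that leaves the root `i`: the tree
of `i` is attached to the tree that contains the end of `e`, the other trees are unchanged. -/
theorem descendsTo_insert_iff (hH : IsInForest H) (hi : ∀ a ∈ H, a.source ≠ i)
    (he : e.source = i) (hF : ¬ DescendsTo H e.target i) {v j : V} (hj : j ≠ i) :
    DescendsTo (insert e H) v j ↔
      (DescendsTo H v i ∧ DescendsTo H e.target j) ∨ DescendsTo H v j := by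
  rw [isInForest_iff] at hH
  obtain ⟨s, hs⟩ := hH e.target
  have hsi : s ≠ i := by rintro rfl; exact hF hs
  have hs' := hs.insert_of_ne hi he hsi
  constructor
  · intro h
    obtain ⟨r, hr⟩ := hH v
    by_cases hri : r = i
    · subst hri
      have := h.unique (hr.insert_of_eq hi he hs')
      subst this
      exact .inl ⟨hr, hs⟩
    · have := h.unique (hr.insert_of_ne hi he hri)
      subst this
      exact .inr hr
  · rintro (⟨h1, h2⟩ | h)
    · exact h1.insert_of_eq hi he (h2.insert_of_ne hi he hj)
    · exact h.insert_of_ne hi he hj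

theorem Arc.weight_pos (a : G.Arc) : 0 < a.weight := G.weight_pos _ _ _

open Classical in
/-- The indicator of `DescendsTo`. -/
noncomputable def descends (H : Finset G.Arc) (v r : V) : ℝ := if DescendsTo H v r then 1 else 0

theorem descends_le_one (H : Finset G.Arc) (v r : V) : descends H v r ≤ 1 := by
  unfold descends; split_ifs <;> norm_num

theorem prod_weight_pos (H : Finset G.Arc) : 0 < ∏ a ∈ H, a.weight :=
  Finset.prod_pos fun a _ => a.weight_pos

end Descent

/-! ### The in-forest matrix -/

section Forests

variable {V : Type*} [Fintype V] {G : WMultidigraph V}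

open Classical in
/-- The arcs that leave `i`. -/
noncomputable def arcsFrom (G : WMultidigraph V) (i : V) : Finset G.Arc :=
  Finset.univ.filter fun a => a.source = i

theorem mem_arcsFrom {i : V} {a : G.Arc} : a ∈ G.arcsFrom i ↔ a.source = i := by
  simp [arcsFrom]

theorem sum_arcsFrom (i : V) (f : V → ℝ) :
    ∑ a ∈ G.arcsFrom i, a.weight * f a.target = ∑ m, G.arcWeight i m * f m := by
  classical
  rw [arcsFrom, Finset.sum_filter, Fintype.sum_sigma, Finset.sum_eq_single i]
  · simp only [Arc.source, if_true]
    rw [Fintype.sum_sigma]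
    refine Finset.sum_congr rfl fun m _ => ?_
    rw [arcWeight, Finset.sum_mul]
    rfl
  · intro k _ hk
    exact Finset.sum_eq_zero fun x _ => if_neg hk
  · simp

open Classical in
/-- The in-forests in which `i` is a root. -/
noncomputable def forestsRootedAt (G : WMultidigraph V) (i : V) : Finset (Finset G.Arc) :=
  Finset.univ.filter fun H => IsInForest H ∧ ∀ a ∈ H, a.source ≠ i

theorem mem_forestsRootedAt {i : V} {H : Finset G.Arc} :
    H ∈ G.forestsRootedAt i ↔ IsInForest H ∧ ∀ a ∈ H, a.source ≠ i := by
  simp [forestsRootedAt]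

open Classical in
/-- Each in-forest is obtained in a unique way from one in which `i` is a root, either as it is or
by inserting an arc that leaves `i`. -/
theorem sum_isInForest_eq (i : V) (Φ : Finset G.Arc → ℝ) (hΦ : ∀ H, ¬ IsInForest H → Φ H = 0) :
    ∑ H, Φ H = ∑ H ∈ G.forestsRootedAt i, (Φ H + ∑ e ∈ G.arcsFrom i, Φ (insert e H)) := by
  have h1 : ∑ H, Φ H = ∑ H ∈ Finset.univ.filter IsInForest, Φ H := by
    rw [Finset.sum_filter]
    refine Finset.sum_congr rfl fun H _ => ?_
    split_ifs with h
    · rfl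
    · exact hΦ H h
  rw [h1, ← Finset.sum_fiberwise_of_maps_to (t := G.forestsRootedAt i)
    (g := fun H => H.filter fun a => a.source ≠ i)]
  swap
  · intro H hH
    exact mem_forestsRootedAt.2
      ⟨(Finset.mem_filter.1 hH).2.filter_source_ne i, fun a ha => (Finset.mem_filter.1 ha).2⟩
  refine Finset.sum_congr rfl fun H₀ hH₀ => ?_
  obtain ⟨hF, hi⟩ := mem_forestsRootedAt.1 hH₀
  have hnot (e : G.Arc) (he : e ∈ G.arcsFrom i) : e ∉ H₀ := fun h => hi e h (mem_arcsFrom.1 he)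
  have hinj : Set.InjOn (fun e => insert e H₀) (G.arcsFrom i : Set G.Arc) := by
    intro e he e' he' h
    have h' : e ∈ insert e' H₀ := by
      rw [← show insert e H₀ = insert e' H₀ from h]; exact Finset.mem_insert_self _ _
    exact (Finset.mem_insert.1 h').resolve_right (hnot e he)
  have hmem : H₀ ∉ (G.arcsFrom i).image fun e => insert e H₀ := by
    intro h
    obtain ⟨e, he, heq⟩ := Finset.mem_image.1 h
    exact hnot e he (by rw [← heq]; exact Finset.mem_insert_self _ _)
  rw [← Finset.sum_image (f := Φ) hinj, ← Finset.sum_insert hmem]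
  refine Finset.sum_subset (fun H hH => ?_) (fun H hH hH' => ?_)
  · obtain ⟨hH1, rfl⟩ := Finset.mem_filter.1 hH
    have hHF := (Finset.mem_filter.1 hH1).2
    -- By the outdegree condition at most one arc of `H` leaves `i`.
    obtain ⟨r, hr⟩ := isInForest_iff.1 hHF i
    rw [Finset.mem_insert]
    cases hr with
    | root _ h0 =>
      left
      exact (Finset.filter_true_of_mem h0).symm
    | step a ha hu =>
      right
      refine Finset.mem_image.2 ⟨a, mem_arcsFrom.2 rfl, ?_⟩
      ext b
      simp only [Finset.mem_insert, Finset.mem_filter]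
      constructor
      · rintro (rfl | ⟨hb, -⟩)
        exacts [ha, hb]
      · intro hb
        by_cases hba : b.source = a.source
        · exact .inl (hu b hb hba)
        · exact .inr ⟨hb, hba⟩
  · refine hΦ H fun hHF => hH' ?_
    refine Finset.mem_filter.2 ⟨Finset.mem_filter.2 ⟨Finset.mem_univ _, hHF⟩, ?_⟩
    rcases Finset.mem_insert.1 hH with rfl | hH
    · exact Finset.filter_true_of_mem hi
    · obtain ⟨e, he, rfl⟩ := Finset.mem_image.1 hH
      rw [Finset.filter_insert, if_neg (by simpa using mem_arcsFrom.1 he),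
        Finset.filter_true_of_mem hi]

open Classical in
theorem inForestMatrix_eq_sum (v j : V) : G.inForestMatrix v j =
    ∑ H : Finset G.Arc, if IsInForest H then descends H v j * ∏ a ∈ H, a.weight else 0 := by
  rw [inForestMatrix, inForests, Finset.sum_filter]
  refine Finset.sum_congr rfl fun H _ => ?_
  by_cases hF : IsInForest H
  · simp [hF, hF.isConvergingTreeAt_iff, descends]
  · simp [hF]

/-- The entries outside column `i`, grouped by the in-forests in which `i` is a root. The two
summands in the inner bracket are the two ways in which `v` can descend to `j` once `e` has been inserted:
through `e`, or without meeting `i`, the factor `1 - descends H e.target i` excluding the cycles. -/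
theorem inForestMatrix_eq_sum_forestsRootedAt_of_ne {i j : V} (hj : j ≠ i) (v : V) :
    G.inForestMatrix v j = ∑ H ∈ G.forestsRootedAt i, (∏ a ∈ H, a.weight) *
      (descends H v j + ∑ e ∈ G.arcsFrom i, e.weight *
        (descends H v i * descends H e.target j + descends H v j * (1 - descends H e.target i))) := by
  classical
  rw [inForestMatrix_eq_sum, sum_isInForest_eq i _ fun H hH => if_neg hH]
  refine Finset.sum_congr rfl fun H hH => ?_
  obtain ⟨hF, hi⟩ := mem_forestsRootedAt.1 hH
  rw [if_pos hF, mul_add, mul_comm, Finset.mul_sum]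
  congr 1
  refine Finset.sum_congr rfl fun e he => ?_
  have he' := mem_arcsFrom.1 he
  rw [Finset.prod_insert fun h => hi e h he', isInForest_insert_iff hF hi he']
  by_cases hcyc : DescendsTo H e.target i
  · have hne : ¬ DescendsTo H e.target j := fun h => hj (h.unique hcyc)
    simp [descends, hcyc, hne]
  · rw [if_pos hcyc]
    have hexcl : DescendsTo H v i → ¬ DescendsTo H v j := fun h h' => hj (h'.unique h)
    simp only [descends, descendsTo_insert_iff hF hi he' hcyc hj, hcyc, if_false]
    by_cases h1 : DescendsTo H v i
    · by_cases h2 : DescendsTo H e.target j <;> simp [h1, hexcl h1, h2, mul_comm]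
    · by_cases h2 : DescendsTo H v j <;> simp [h1, h2, mul_comm]

/-- In column `i` only the in-forests in which `i` is a root contribute. -/
theorem inForestMatrix_self_eq_sum_forestsRootedAt (i v : V) :
    G.inForestMatrix v i = ∑ H ∈ G.forestsRootedAt i, (∏ a ∈ H, a.weight) * descends H v i := by
  classical
  rw [inForestMatrix_eq_sum, sum_isInForest_eq i _ fun H hH => if_neg hH]
  refine Finset.sum_congr rfl fun H hH => ?_
  obtain ⟨hF, hi⟩ := mem_forestsRootedAt.1 hH
  rw [if_pos hF, mul_comm, Finset.sum_eq_zero, add_zero]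
  intro e he
  have : ¬ DescendsTo (insert e H) v i := fun h =>
    h.not_source e (Finset.mem_insert_self _ _) (mem_arcsFrom.1 he)
  simp [descends, this]

theorem descends_self_of_mem {i : V} {H : Finset G.Arc} (hH : H ∈ G.forestsRootedAt i) :
    descends H i i = 1 :=
  if_pos (.root i (mem_forestsRootedAt.1 hH).2)

theorem descends_of_mem_of_ne {i j : V} {H : Finset G.Arc} (hH : H ∈ G.forestsRootedAt i)
    (hj : j ≠ i) : descends H i j = 0 :=
  if_neg fun h => hj (h.eq_of_forall_source_ne (mem_forestsRootedAt.1 hH).2)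

theorem empty_mem_forestsRootedAt (i : V) : ∅ ∈ G.forestsRootedAt i :=
  mem_forestsRootedAt.2 ⟨isInForest_empty, by simp⟩

theorem isBalanced_inForestMatrix (G : WMultidigraph V) : G.IsBalanced G.inForestMatrix := by
  classical
  refine ⟨fun i => 1 + ∑ e ∈ G.arcsFrom i, e.weight,
    fun i => ∑ H ∈ G.forestsRootedAt i, (∏ a ∈ H, a.weight) *
      (1 + ∑ e ∈ G.arcsFrom i, e.weight * (1 - descends H e.target i)),
    fun i => ?_, fun i => ?_, fun i j => ?_⟩
  · exact add_pos_of_pos_of_nonneg one_pos (Finset.sum_nonneg fun e _ => e.weight_pos.le)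
  · refine Finset.sum_pos (fun H _ => mul_pos (prod_weight_pos H) ?_)
      ⟨∅, empty_mem_forestsRootedAt i⟩
    exact add_pos_of_pos_of_nonneg one_pos (Finset.sum_nonneg fun e _ =>
      mul_nonneg e.weight_pos.le (sub_nonneg.2 (descends_le_one _ _ _)))
  rw [← sum_arcsFrom i fun m => G.inForestMatrix m j]
  by_cases hij : i = j
  · subst hij
    simp only [inForestMatrix_self_eq_sum_forestsRootedAt, if_true, Finset.mul_sum]
    rw [Finset.sum_comm, ← Finset.sum_add_distrib]
    refine Finset.sum_congr rfl fun H hH => ?_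
    rw [descends_self_of_mem hH]
    simp only [mul_sub, mul_one, Finset.sum_sub_distrib, mul_add, mul_left_comm _ (∏ a ∈ H, _),
      ← Finset.mul_sum]
    ring
  · have hj : j ≠ i := fun h => hij h.symm
    simp only [inForestMatrix_eq_sum_forestsRootedAt_of_ne hj, if_neg hij, add_zero]
    simp only [Finset.mul_sum (G.forestsRootedAt i)]
    rw [Finset.sum_comm]
    refine Finset.sum_congr rfl fun H hH => ?_
    rw [descends_self_of_mem hH, descends_of_mem_of_ne hH hj]
    -- With `α k` the total weight of the arcs from `i` into the tree of `k` and `E` that of all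
    -- arcs from `i`, both sides are `α j * (1 + E)` times the weight of `H`.
    obtain ⟨E, hE⟩ : ∃ E, E = ∑ e ∈ G.arcsFrom i, e.weight := ⟨_, rfl⟩
    obtain ⟨α, hα⟩ : ∃ α : V → ℝ, ∀ k, ∑ e ∈ G.arcsFrom i, e.weight * descends H e.target k = α k :=
      ⟨_, fun _ => rfl⟩
    have inner (x y : ℝ) : ∑ e ∈ G.arcsFrom i, e.weight *
        (x * descends H e.target j + y * (1 - descends H e.target i)) =
          x * α j + y * (E - α i) := by
      rw [hE, ← hα, ← hα, ← Finset.sum_sub_distrib, Finset.mul_sum, Finset.mul_sum,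
        ← Finset.sum_add_distrib]
      exact Finset.sum_congr rfl fun e _ => by ring
    simp only [inner, ← hE]
    have outer : ∑ a ∈ G.arcsFrom i, a.weight * ((∏ a ∈ H, a.weight) *
        (descends H a.target j + (descends H a.target i * α j +
          descends H a.target j * (E - α i)))) =
        (∏ a ∈ H, a.weight) * (α j + (α i * α j + α j * (E - α i))) := by
      rw [← hα j, ← hα i, Finset.sum_mul, Finset.sum_mul, ← Finset.sum_add_distrib,
        ← Finset.sum_add_distrib, Finset.mul_sum]
      exact Finset.sum_congr rfl fun e _ => by ring
    rw [outer]
    ring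

theorem inForestMatrix_nonneg (i j : V) : 0 ≤ G.inForestMatrix i j :=
  Finset.sum_nonneg fun H _ => (prod_weight_pos H).le

/-- By the balance equation, positivity propagates backwards along routes, starting from the
diagonal entries, to which the empty forest contributes. -/
theorem inForestMatrix_pos (hG : G.IsStrong) (i j : V) : 0 < G.inForestMatrix i j := by
  classical
  obtain ⟨d, c, hd, hc, heq⟩ := G.isBalanced_inForestMatrix
  obtain ⟨r, -⟩ := hG i j
  have hsum (v j : V) : ∀ m ∈ Finset.univ, 0 ≤ G.arcWeight v m * G.inForestMatrix m j :=
    fun m _ => mul_nonneg (arcWeight_nonneg v m) (inForestMatrix_nonneg m j)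
  induction r with
  | nil j =>
    refine pos_of_mul_pos_right ?_ (hd j).le
    rw [heq j j, if_pos rfl]
    exact add_pos_of_nonneg_of_pos (Finset.sum_nonneg (hsum j j)) (hc j)
  | @cons i m j a r ih =>
    refine pos_of_mul_pos_right ?_ (hd i).le
    rw [heq i j]
    refine add_pos_of_pos_of_nonneg ?_ (by split_ifs; exacts [(hc j).le, le_rfl])
    exact Finset.sum_pos' (hsum i j) ⟨m, Finset.mem_univ m, mul_pos (arcWeight_pos a) ih⟩

end Forests

end WMultidigraph

theorem mainTheorem9 {V : Type*} [Fintype V] :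
    (∀ G : WMultidigraph V, G.Loopless → G.IsStrong →
      G.HasLogDistance G.inForestMatrix ∧ G.IsGraphGeodetic (logDistance G.inForestMatrix)) ∧
    (∀ G : WMultidigraph V, G.IsStrong → G.FiniteRouteWeights →
      G.HasLogDistance G.routeMatrix ∧ G.IsGraphGeodetic (logDistance G.routeMatrix)) :=
  ⟨fun G _ hG =>
    G.isBalanced_inForestMatrix.hasLogDistance_and_isGraphGeodetic hG
      (WMultidigraph.inForestMatrix_pos hG),
  fun _ hG hfin =>
    (WMultidigraph.isBalanced_routeMatrix hfin).hasLogDistance_and_isGraphGeodetic hG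
      (WMultidigraph.routeMatrix_pos hG hfin)⟩
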